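/- For an infinite cardinal $\mu$, let $\square_\mu$ be the statement: there is a sequence $\langle C_\alpha \mid \alpha<\mu^+,\ \alpha \text{ limit}\rangle$ such that each $C_\alpha$ is a closed unbounded subset of $\alpha$ of order type at most $\mu$, and $C_\beta=C_\alpha\cap\beta$ whenever $\beta$ is a limit point of $C_\alpha$. For $k\in\omega$, let $\overline{M}_k$ be the join-semilattice on $\{0,\dots,k-1\}\sqcup\{\mathbf 1\}$ in which any two distinct elements have join $\mathbf 1$; a join-semilattice is $\overline{M}_k$-free if it has no join-subsemilattice isomorphic to $\overline{M}_k$. For $k\in\omega$ and an infinite cardinal $\kappa$, a $(k,\kappa)$-ladder is a nonempty $\overline{M}_{k+1}$-free lattice all of whose principal ideals have cardinality $<\kappa$. Given an ordinal $\gamma$, a lattice $B$ with least element $\mathbf 0$, and a map $\varrho:[\gamma]^2\to B$, extended by $\varrho(\alpha,\alpha)=\mathbf 0$, let $\trianglelefteq_\varrho$ be the relation on $\gamma\times B$ defined by $$(\alpha,p)\trianglelefteq_\varrho(\beta,q)\iff \alpha\le\beta\ \text{ and }\ p\vee\varrho(\alpha,\beta)\le q,$$ and let $D_\varrho(\alpha,p)=\{\eta<\alpha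 \mid \varrho(\eta,\alpha)\le p\}$ for $\alpha<\gamma$ and $p\in B$. Special ladders are defined recursively: the special $(0,\kappa)$-ladder is the one-point lattice, and a special $(k+1,\kappa)$-ladder is a $(k+1,\kappa)$-ladder that is (up to isomorphism) of the form $(\gamma\times B,\trianglelefteq_\varrho)$, where $\gamma$ is an ordinal, $B$ is a special $(k,\kappa)$-ladder, and $\varrho:[\gamma]^2\to B$ satisfies $\varrho(0,\alpha)=\mathbf 0$ for all $\alpha<\gamma$. **Theorem.** Let $\kappa$ be an infinite cardinal and $n\in\omega$. If $\square_{\kappa^{+m}}$ holds for every $m<n$, then there is an $(n+1,\kappa)$-ladder of cardinality $\kappa^{+n}$. Moreover, this ladder can be taken to be special, of the form $(\gamma\times B,\trianglelefteq_\varrho)$ as above with $B$ a special $(n,\kappa)$-ladder, and such that, for every $\alpha<\gamma$ and $p\in B$, the set $D_\varrho(\alpha,p)$ is closed in $\alpha$ (with respect to the order topology). -/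

import Mathlib

open Cardinal

universe u v

namespace Ladder

/-- The `n`-th successor cardinal `κ^{+n}` of `κ`. -/
noncomputable def succIter (κ : Cardinal.{u}) (n : ℕ) : Cardinal.{u} :=
  (Order.succ : Cardinal.{u} → Cardinal.{u})^[n] κ

/-- `β` is a limit point of the set of ordinals `S`: `β ≠ 0` and `S ∩ β` is unbounded in `β`.
(Such a `β` is a limit ordinal.) -/
def IsLimitPoint (β : Ordinal.{u}) (S : Set Ordinal.{u}) : Prop :=
  β ≠ 0 ∧ ∀ δ < β, ∃ η ∈ S, δ < η ∧ η < β

/-- `S` is closed in `α` for the order topology of `α`: it contains its limit points below `α`. -/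
def IsClosedIn (S : Set Ordinal.{u}) (α : Ordinal.{u}) : Prop :=
  ∀ β < α, IsLimitPoint β S → β ∈ S

/-- Jensen's square principle `□_μ`: there is a sequence `⟨C_α ∣ α < μ⁺, α limit⟩` such that
`C_α` is a closed and unbounded subset of `α`, `otp(C_α) ≤ μ`, and `C_β = C_α ∩ β` whenever `β` is
a limit point of `C_α`. The order type of `C_α` is computed one universe up, as `C_α` is a set of
ordinals; the values of `C` outside the limit ordinals below `μ⁺` are irrelevant. -/
def Square (μ : Cardinal.{u}) : Prop :=
  ∃ C : Ordinal.{u} → Set Ordinal.{u},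
    ∀ α : Ordinal.{u}, α < (Order.succ μ).ord → Order.IsSuccLimit α →
      C α ⊆ Set.Iio α ∧
      (∀ β < α, ∃ η ∈ C α, β < η) ∧
      IsClosedIn (C α) α ∧
      Ordinal.type (fun x y : C α => x < y) ≤ Ordinal.lift.{u + 1, u} μ.ord ∧
      ∀ β : Ordinal.{u}, IsLimitPoint β (C α) → C β = C α ∩ Set.Iio β

/-- The underlying set `X ⊔ {1}` of the join-semilattice `M̄_X`. -/
inductive MBar (X : Type v) : Type v
  | atom (x : X) : MBar X
  | one : MBar X

open Classical in
/-- The join of `M̄_X`: distinct elements have join `1`. -/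
noncomputable def MBar.join {X : Type v} (x y : MBar X) : MBar X := if x = y then x else MBar.one

noncomputable instance (X : Type v) : Max (MBar X) := ⟨MBar.join⟩

theorem MBar.sup_self {X : Type v} (x : MBar X) : x ⊔ x = x := if_pos rfl

theorem MBar.sup_of_ne {X : Type v} {x y : MBar X} (h : x ≠ y) : x ⊔ y = MBar.one := if_neg h

theorem MBar.sup_one {X : Type v} (x : MBar X) : x ⊔ MBar.one = MBar.one := by
  by_cases h : x = MBar.one
  · rw [h, MBar.sup_self]
  · exact MBar.sup_of_ne h

theorem MBar.sup_comm' {X : Type v} (x y : MBar X) : x ⊔ y = y ⊔ x := by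
  by_cases h : x = y
  · rw [h]
  · rw [MBar.sup_of_ne h, MBar.sup_of_ne (Ne.symm h)]

theorem MBar.one_sup {X : Type v} (x : MBar X) : MBar.one ⊔ x = MBar.one := by
  rw [MBar.sup_comm', MBar.sup_one]

theorem MBar.sup_assoc' {X : Type v} (x y z : MBar X) : x ⊔ y ⊔ z = x ⊔ (y ⊔ z) := by
  by_cases h : x = y
  · subst h
    rw [MBar.sup_self]
    by_cases h' : x = z
    · rw [h', MBar.sup_self, MBar.sup_self]
    · rw [MBar.sup_of_ne h', MBar.sup_one]
  · rw [MBar.sup_of_ne h, MBar.one_sup]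
    by_cases h' : y = z
    · rw [← h', MBar.sup_self, MBar.sup_of_ne h]
    · rw [MBar.sup_of_ne h', MBar.sup_one]

noncomputable instance (X : Type v) : SemilatticeSup (MBar X) :=
  SemilatticeSup.mk' MBar.sup_comm' MBar.sup_assoc' MBar.sup_self

/-- `M̄_n`-freeness: there is no join-subsemilattice isomorphic to `M̄_n`, i.e. there is no injective
join-homomorphism defined on `M̄_n`. -/
def MBarFree (n : ℕ) (P : Type u) [SemilatticeSup P] : Prop :=
  ¬ ∃ f : SupHom (MBar (Fin n)) P, Function.Injective f

/-- `(n, κ)`-ladders: nonempty `M̄_{n+1}`-free lattices whose principal ideals have cardinality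
`< κ`. -/
structure IsLadder (n : ℕ) (κ : Cardinal.{u}) (P : Type u) [Lattice P] : Prop where
  nonempty : Nonempty P
  free : MBarFree (n + 1) P
  card_Iic_lt : ∀ p : P, #(Set.Iic p) < κ

/-- The relation `⊴_ρ` on `γ × B`. A map `[γ]² → B` is given by its values `ρ α β` for
`α < β < γ`, extended by `ρ α α = 0`; no other values are used. -/
def TriLE {B : Type u} [Lattice B] (γ : Ordinal.{u}) (ρ : Ordinal.{u} → Ordinal.{u} → B)
    (x y : Set.Iio γ × B) : Prop :=
  x.1 ≤ y.1 ∧ x.2 ⊔ ρ x.1 y.1 ≤ y.2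

/-- `D_ρ(α, p) = {η < α ∣ ρ(η, α) ≤ p}`. -/
def D {B : Type u} [Lattice B] (ρ : Ordinal.{u} → Ordinal.{u} → B) (α : Ordinal.{u}) (p : B) :
    Set Ordinal.{u} :=
  {η | η < α ∧ ρ η α ≤ p}

/-- The lattice `P` is (isomorphic to) `(γ × B, ⊴_ρ)`, where `B` has a least element `0`, where
`ρ(α, α) = 0` by convention, and where `ρ(0, α) = 0` for all `α < γ`. -/
structure IsPresentedBy (P : Type u) [Lattice P] (γ : Ordinal.{u}) (B : Type u) [Lattice B]
    [OrderBot B] (ρ : Ordinal.{u} → Ordinal.{u} → B) : Prop where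
  diag : ∀ α < γ, ρ α α = ⊥
  zero : ∀ α < γ, ρ 0 α = ⊥
  exists_equiv : ∃ e : P ≃ Set.Iio γ × B, ∀ x y : P, x ≤ y ↔ TriLE γ ρ (e x) (e y)

/-- Special `(n, κ)`-ladders. The special `(0, κ)`-ladder is the one-point lattice; a special
`(n + 1, κ)`-ladder is an `(n + 1, κ)`-ladder of the form `(γ × B, ⊴_ρ)` with `γ` an ordinal, `B` a
special `(n, κ)`-ladder and `ρ(0, α) = 0` for all `α < γ`. -/
def IsSpecialLadder (κ : Cardinal.{u}) : ℕ → ∀ (P : Type u) [Lattice P], Prop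
  | 0, P, _ => Nonempty P ∧ Subsingleton P
  | n + 1, P, _ => IsLadder (n + 1) κ P ∧
      ∃ (γ : Ordinal.{u}) (B : Type u) (_ : Lattice B) (_ : OrderBot B)
        (ρ : Ordinal.{u} → Ordinal.{u} → B),
        IsSpecialLadder κ n B ∧ IsPresentedBy P γ B ρ

end Ladder

namespace Ladder

/-! The proof is by induction on `n`, multiplying a ladder `B` of size `μ = κ^{+n}` by `μ⁺`.
Subadditivity of `ρ`, in two forms, makes `⊴_ρ` transitive and gives joins; closedness of the sets
`D ρ α p` gives meets; their having size `< κ` keeps principal ideals small. First coordinates of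
joins are maxima, so all but at most one atom of a copy of `M̄_{k+1}` lie in the fibre of its top,
where joins are those of `B`. Hence `M̄_k`-freeness of `B` gives `M̄_{k+1}`-freeness of the product.

The map `ρ` is obtained from `□_μ` by walking from `β` down to `α`. Stepping to the first `c ∈ C β`
with `α ≤ c` contributes the index of `c` in `C β`, coded in `B` by an injection `g` of `μ`. Since
`g` is injective, at most `#(Set.Iic p)` first steps are compatible with the bound `p`, which bounds
`D ρ β p`. For subadditivity (`walk_subadditive`) a step also records the mutual distances in the
tail of `c`, the finite set of points of `C β` from the last limit point up to `c`. Points below the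
tail are handled by coherence: walks from `β` and from a limit point of `C β` agree.

Closedness (`isClosedIn_D_walk`) needs preimages under `g` of principal ideals to be closed. In the
new ladder `j ↦ (j, ⊥)` again has this property, so the induction continues. -/

/-! ### Limit points and finite tails. -/

theorem IsLimitPoint.mono {S T : Set Ordinal.{u}} {β : Ordinal.{u}} (h : IsLimitPoint β S)
    (hST : S ⊆ T) : IsLimitPoint β T :=
  ⟨h.1, fun δ hδ => let ⟨η, hη, h'⟩ := h.2 δ hδ; ⟨η, hST hη, h'⟩⟩

theorem IsLimitPoint.inter_Iio {S : Set Ordinal.{u}} {β γ : Ordinal.{u}} (h : IsLimitPoint β S)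
    (hβ : β ≤ γ) : IsLimitPoint β (S ∩ Set.Iio γ) :=
  ⟨h.1, fun δ hδ => let ⟨η, hη, h₁, h₂⟩ := h.2 δ hδ; ⟨η, ⟨hη, h₂.trans_le hβ⟩, h₁, h₂⟩⟩

theorem IsLimitPoint.isSuccLimit {S : Set Ordinal.{u}} {β : Ordinal.{u}} (h : IsLimitPoint β S) :
    Order.IsSuccLimit β := by
  rcases Ordinal.zero_or_succ_or_isSuccLimit β with h0 | ⟨δ, rfl⟩ | hl
  · exact absurd h0 h.1
  · obtain ⟨η, -, h₁, h₂⟩ := h.2 δ (Order.lt_succ δ)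
    exact absurd h₁ (not_lt.2 (Order.lt_succ_iff.1 h₂))
  · exact hl

/-- A supremum of limit points of `S` is a limit point of `S`. -/
theorem isLimitPoint_csSup {S A : Set Ordinal.{u}} (hne : A.Nonempty) (hb : BddAbove A)
    (hA : ∀ a ∈ A, IsLimitPoint a S) : IsLimitPoint (sSup A) S := by
  obtain ⟨a, ha⟩ := hne
  refine ⟨fun h0 => (hA a ha).1 ?_, fun δ hδ => ?_⟩
  · exact le_antisymm (h0 ▸ le_csSup hb ha) zero_le
  · obtain ⟨b, hbA, hb'⟩ := exists_lt_of_lt_csSup ⟨a, ha⟩ hδ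
    obtain ⟨η, hη, h₁, h₂⟩ := (hA b hbA).2 δ hb'
    exact ⟨η, hη, h₁, h₂.trans_le (le_csSup hb hbA)⟩

/-- A bounded infinite set of ordinals has a limit point. -/
theorem exists_isLimitPoint_of_infinite {S : Set Ordinal.{u}} (hS : S.Infinite) {c : Ordinal.{u}}
    (hc : ∀ s ∈ S, s ≤ c) : ∃ β ≤ c, IsLimitPoint β S := by
  let A : Set Ordinal.{u} := {β | (S ∩ Set.Iio β).Infinite}
  have hA : A.Nonempty := by
    refine ⟨Order.succ c, ?_⟩
    have : S ∩ Set.Iio (Order.succ c) = S :=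
      Set.inter_eq_left.2 fun s hs => Order.lt_succ_iff.2 (hc s hs)
    change (S ∩ Set.Iio (Order.succ c)).Infinite
    rwa [this]
  have hmem : sInf A ∈ A := csInf_mem hA
  have hfin : ∀ δ < sInf A, (S ∩ Set.Iio δ).Finite := fun δ hδ =>
    Set.not_infinite.1 fun h => not_lt.2 (csInf_le' (show δ ∈ A from h)) hδ
  refine ⟨sInf A, csInf_le' ?_, ?_, fun δ hδ => ?_⟩
  · by_contra h
    refine hS (((Set.not_infinite.1 h).union (Set.finite_singleton c)).subset fun s hs => ?_)
    rcases (hc s hs).lt_or_eq with h | h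
    · exact Or.inl ⟨hs, h⟩
    · exact Or.inr h
  · intro h0
    apply hmem
    rw [h0]
    convert Set.finite_empty
    ext x
    simp
  · have : (S ∩ Set.Iic δ).Finite := by
      refine ((hfin δ hδ).union (Set.finite_singleton δ)).subset fun s hs => ?_
      rcases lt_or_eq_of_le (Set.mem_Iic.1 hs.2) with h | h
      · exact Or.inl ⟨hs.1, h⟩
      · exact Or.inr h
    obtain ⟨η, hη, hη'⟩ := Set.Infinite.exists_notMem_finite hmem this
    exact ⟨η, hη.1, not_le.1 fun h => hη' ⟨hη.1, h⟩, hη.2⟩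

/-- The points of `C` up to `c` that are above all limit points of `C` up to `c`. -/
def tail (C : Set Ordinal.{u}) (c : Ordinal.{u}) : Set Ordinal.{u} :=
  {d | d ∈ C ∧ d ≤ c ∧ ∀ l ≤ c, IsLimitPoint l C → l ≤ d}

/-- A limit point `l ≤ c` of an infinite tail would be a limit point of `C`, so no tail element
could lie below it. -/
theorem tail_finite (C : Set Ordinal.{u}) (c : Ordinal.{u}) : (tail C c).Finite := by
  by_contra h
  obtain ⟨l, hl, hlim⟩ := exists_isLimitPoint_of_infinite h fun s hs => hs.2.1
  obtain ⟨d, hd, -, hd'⟩ := hlim.2 0 (pos_iff_ne_zero.2 hlim.1)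
  exact not_le.2 hd' (hd.2.2 l hl (hlim.mono fun x hx => hx.1))

theorem self_mem_tail {C : Set Ordinal.{u}} {c : Ordinal.{u}} (hc : c ∈ C) : c ∈ tail C c :=
  ⟨hc, le_rfl, fun _ h _ => h⟩

theorem tail_subset {C : Set Ordinal.{u}} {c d : Ordinal.{u}} (hd : d ∈ tail C c) :
    tail C d ⊆ tail C c := fun _ he =>
  ⟨he.1, he.2.1.trans hd.2.1, fun l hl hlim => he.2.2 l (hd.2.2 l hl hlim) hlim⟩

theorem tail_eq_singleton {C : Set Ordinal.{u}} {c : Ordinal.{u}} (hc : c ∈ C)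
    (h : IsLimitPoint c C) : tail C c = {c} :=
  Set.eq_singleton_iff_unique_mem.2
    ⟨self_mem_tail hc, fun _ hd => le_antisymm hd.2.1 (hd.2.2 c le_rfl h)⟩

theorem tail_eq_singleton_of_forall_le {C : Set Ordinal.{u}} {c : Ordinal.{u}} (hc : c ∈ C)
    (h : ∀ d ∈ C, c ≤ d) : tail C c = {c} :=
  Set.eq_singleton_iff_unique_mem.2
    ⟨self_mem_tail hc, fun d hd => le_antisymm hd.2.1 (h d hd.1)⟩

theorem tail_inter_Iio {C : Set Ordinal.{u}} {c l : Ordinal.{u}} (hc : c < l) :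
    tail (C ∩ Set.Iio l) c = tail C c := by
  ext d
  constructor
  · exact fun h => ⟨h.1.1, h.2.1, fun m hm hlim => h.2.2 m hm (hlim.inter_Iio (hm.trans hc.le))⟩
  · exact fun h => ⟨⟨h.1, h.2.1.trans_lt hc⟩, h.2.1,
      fun m hm hlim => h.2.2 m hm (hlim.mono Set.inter_subset_left)⟩

/-- If `d ≤ c` are points of a set that is closed below `β > c`, and `d` is not in the tail of `c`,
then some limit point lies in the tail of `c` above `d`. -/
theorem exists_isLimitPoint_mem_tail {C : Set Ordinal.{u}} {β c d : Ordinal.{u}}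
    (hC : IsClosedIn C β) (hc : c < β) (hdC : d ∈ C) (hdc : d ≤ c) (hd : d ∉ tail C c) :
    ∃ l ∈ tail C c, d < l ∧ IsLimitPoint l C := by
  have : ∃ l ≤ c, IsLimitPoint l C ∧ d < l := by
    by_contra! h
    exact hd ⟨hdC, hdc, h⟩
  obtain ⟨m, hmc, hm, hdm⟩ := this
  -- The witness is the largest limit point up to `c`: the supremum of `A` is again a limit point,
  -- and closedness puts it in `C`.
  let A : Set Ordinal.{u} := {l | l ≤ c ∧ IsLimitPoint l C}
  have hA : A.Nonempty := ⟨m, hmc, hm⟩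
  have hb : BddAbove A := ⟨c, fun x hx => hx.1⟩
  have hlim : IsLimitPoint (sSup A) C := isLimitPoint_csSup hA hb fun a ha => ha.2
  have hle : sSup A ≤ c := csSup_le hA fun x hx => hx.1
  exact ⟨sSup A, ⟨hC _ (hle.trans_lt hc) hlim, hle, fun l hl hl' => le_csSup hb ⟨hl, hl'⟩⟩,
    hdm.trans_le (le_csSup hb ⟨hmc, hm⟩), hlim⟩

/-! ### Indices along a set, and coherent sequences from square. -/

/-- The order type of `C ∩ d`. -/
noncomputable def idx (C : Set Ordinal.{u}) (d : Ordinal.{u}) : Ordinal.{u} :=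
  ⨆ e : Set.Iio d, ⨆ _ : e.1 ∈ C, Order.succ (idx C e.1)
termination_by d
decreasing_by exact e.2

theorem idx_le_iff {C : Set Ordinal.{u}} {d o : Ordinal.{u}} :
    idx C d ≤ o ↔ ∀ e ∈ C, e < d → idx C e < o := by
  rw [idx, Ordinal.iSup_le_iff]
  constructor
  · intro h e he hed
    have := h ⟨e, hed⟩
    rw [ciSup_pos he] at this
    exact Order.succ_le_iff.1 this
  · exact fun h e => Ordinal.iSup_le fun he => Order.succ_le_of_lt (h _ he e.2)

theorem idx_lt_idx {C : Set Ordinal.{u}} {e d : Ordinal.{u}} (he : e ∈ C) (hed : e < d) :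
    idx C e < idx C d :=
  idx_le_iff.1 le_rfl e he hed

theorem exists_le_idx {C : Set Ordinal.{u}} {d o : Ordinal.{u}} (h : o < idx C d) :
    ∃ e ∈ C, e < d ∧ o ≤ idx C e := by
  by_contra! h'
  exact not_lt.2 (idx_le_iff.2 h') h

theorem idx_inter_Iio {C : Set Ordinal.{u}} {d l : Ordinal.{u}} (hd : d ≤ l) :
    idx (C ∩ Set.Iio l) d = idx C d := by
  induction d using WellFoundedLT.induction with
  | ind d ih =>
    refine eq_of_forall_ge_iff fun o => ?_
    rw [idx_le_iff, idx_le_iff]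
    constructor
    · intro h e he hed
      rw [← ih e hed (hed.le.trans hd)]
      exact h e ⟨he, hed.trans_le hd⟩ hed
    · intro h e he hed
      rw [ih e hed (hed.le.trans hd)]
      exact h e he.1 hed

theorem idx_eq_zero {C : Set Ordinal.{u}} {d : Ordinal.{u}} (h : ∀ e ∈ C, d ≤ e) : idx C d = 0 :=
  le_antisymm (idx_le_iff.2 fun e he hed => absurd hed (not_lt.2 (h e he))) zero_le

/-- This turns the order type bound in `Square` into a bound on `idx`. -/
theorem idx_le_of_strictMonoOn {C : Set Ordinal.{u}} {f : Ordinal.{u} → Ordinal.{u}}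
    (hf : StrictMonoOn f C) {d : Ordinal.{u}} (hd : d ∈ C) : idx C d ≤ f d := by
  induction d using WellFoundedLT.induction with
  | ind d ih => exact idx_le_iff.2 fun e he hed => (ih e hed he).trans_lt (hf he hd hed)

/-- A coherent `C`-sequence of length `δ` with order types at most `o`, covering successors. -/
structure IsCoherentSeq (o δ : Ordinal.{u}) (C : Ordinal.{u} → Set Ordinal.{u}) : Prop where
  lt : ∀ {β}, β < δ → ∀ {c}, c ∈ C β → c < β
  cofinal : ∀ {β}, β < δ → ∀ {α}, α < β → ∃ c ∈ C β, α ≤ c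
  closed : ∀ {β}, β < δ → IsClosedIn (C β) β
  idx_lt : ∀ {β}, β < δ → ∀ {c}, c ∈ C β → idx (C β) c < o
  coherent : ∀ {β}, β < δ → ∀ {l}, IsLimitPoint l (C β) → C l = C β ∩ Set.Iio l

theorem Square.exists_isCoherentSeq {μ : Cardinal.{u}} (hμ : ℵ₀ ≤ μ) (h : Square μ) :
    ∃ C, IsCoherentSeq μ.ord (Order.succ μ).ord C := by
  classical
  obtain ⟨C, hC⟩ := h
  -- At a successor the set is the singleton of the predecessor, and at `0` it is empty; neither has
  -- limit points, so coherence is not affected.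
  let C' : Ordinal.{u} → Set Ordinal.{u} := fun β =>
    if Order.IsSuccLimit β then C β else {η | IsGreatest (Set.Iio β) η}
  have hlim : ∀ β, Order.IsSuccLimit β → C' β = C β := fun β h => if_pos h
  have hsucc : ∀ β, ¬ Order.IsSuccLimit β → C' β = {η | IsGreatest (Set.Iio β) η} :=
    fun β h => if_neg h
  have hnolim : ∀ β, ¬ Order.IsSuccLimit β → ∀ l, ¬ IsLimitPoint l (C' β) := by
    intro β hβ l hl
    rw [hsucc β hβ] at hl
    obtain ⟨η, hη, -, hηl⟩ := hl.2 0 (pos_iff_ne_zero.2 hl.1)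
    obtain ⟨η', hη', h', -⟩ := hl.2 η hηl
    exact h'.ne (hη.unique hη')
  refine ⟨C', ⟨?_, ?_, ?_, ?_, ?_⟩⟩
  · intro β hβ c hc
    by_cases h : Order.IsSuccLimit β
    · rw [hlim β h] at hc
      exact (hC β hβ h).1 hc
    · rw [hsucc β h] at hc
      exact hc.1
  · intro β hβ α hα
    by_cases h : Order.IsSuccLimit β
    · rw [hlim β h]
      obtain ⟨η, hη, h'⟩ := (hC β hβ h).2.1 α hα
      exact ⟨η, hη, h'.le⟩
    · rw [hsucc β h]
      rcases Ordinal.zero_or_succ_or_isSuccLimit β with h0 | ⟨η, rfl⟩ | hl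
      · simp [h0] at hα
      · exact ⟨η, ⟨Order.lt_succ η, fun x hx => Order.lt_succ_iff.1 hx⟩, Order.lt_succ_iff.1 hα⟩
      · exact absurd hl h
  · intro β hβ
    by_cases h : Order.IsSuccLimit β
    · rw [hlim β h]
      exact (hC β hβ h).2.2.1
    · exact fun l _ hl => absurd hl (hnolim β h l)
  · intro β hβ c hc
    by_cases h : Order.IsSuccLimit β
    · rw [hlim β h] at hc ⊢
      have ht := (hC β hβ h).2.2.2.1
      rw [← Ordinal.type_lt_Iio] at ht
      obtain ⟨f⟩ := Ordinal.type_le_iff'.1 ht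
      let F : Ordinal.{u} → Ordinal.{u} := fun x => if hx : x ∈ C β then (f ⟨x, hx⟩).1 else 0
      have hF : ∀ x (hx : x ∈ C β), F x = (f ⟨x, hx⟩).1 := fun x hx => dif_pos hx
      have hmono : StrictMonoOn F (C β) := by
        intro x hx y hy hxy
        rw [hF x hx, hF y hy]
        exact f.map_rel_iff.2 hxy
      refine (idx_le_of_strictMonoOn hmono hc).trans_lt ?_
      rw [hF c hc]
      exact (f ⟨c, hc⟩).2
    · rw [hsucc β h] at hc ⊢
      have h0 : idx {η | IsGreatest (Set.Iio β) η} c = 0 :=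
        idx_eq_zero fun e he => (IsGreatest.unique hc he).le
      rw [h0]
      exact (Cardinal.isSuccLimit_ord hμ).bot_lt
  · intro β hβ l hl
    by_cases h : Order.IsSuccLimit β
    · rw [hlim β h] at hl ⊢
      rw [hlim l hl.isSuccLimit]
      exact (hC β hβ h).2.2.2.2 l hl
    · exact absurd hl (hnolim β h l)

/-! ### The walk distance: subadditivity, closedness and small fibres. -/

/-- An injection of the ordinal `o` into `B` with `g 0 = ⊥` such that the preimages of principal
ideals are closed. -/
structure IsIndexing {B : Type u} [Lattice B] [OrderBot B] (o : Ordinal.{u})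
    (g : Ordinal.{u} → B) : Prop where
  zero : g 0 = ⊥
  injOn : Set.InjOn g (Set.Iio o)
  closed : ∀ p : B, IsClosedIn {i | i < o ∧ g i ≤ p} o

section Walk

variable {B : Type u} [Lattice B] [OrderBot B]

/-- The first element of `C` that is at least `α`. -/
noncomputable def next (C : Set Ordinal.{u}) (α : Ordinal.{u}) : Ordinal.{u} :=
  sInf {η | η ∈ C ∧ α ≤ η}

theorem next_mem {C : Set Ordinal.{u}} {α : Ordinal.{u}} (h : ∃ c ∈ C, α ≤ c) :
    next C α ∈ C ∧ α ≤ next C α :=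
  csInf_mem (s := {η | η ∈ C ∧ α ≤ η}) h

theorem next_le {C : Set Ordinal.{u}} {α c : Ordinal.{u}} (hc : c ∈ C) (h : α ≤ c) :
    next C α ≤ c :=
  csInf_le' ⟨hc, h⟩

theorem next_eq {C : Set Ordinal.{u}} {α c : Ordinal.{u}} (hc : c ∈ C) (h : α ≤ c)
    (h' : ∀ d ∈ C, α ≤ d → c ≤ d) : next C α = c :=
  have := next_mem ⟨c, hc, h⟩
  le_antisymm (next_le hc h) (h' _ this.1 this.2)

/-- The join, over the tail of `c` in `C`, of the indices and of the values of `r`. -/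
noncomputable def tailSup (g : Ordinal.{u} → B) (C : Set Ordinal.{u})
    (r : Ordinal.{u} → Ordinal.{u} → B) (c : Ordinal.{u}) : B :=
  (tail_finite C c).toFinset.sup fun d =>
    g (idx C d) ⊔ (tail_finite C c).toFinset.sup fun e => r e d

theorem idx_le_tailSup {g : Ordinal.{u} → B} {C : Set Ordinal.{u}}
    {r : Ordinal.{u} → Ordinal.{u} → B} {c d : Ordinal.{u}} (hd : d ∈ tail C c) :
    g (idx C d) ≤ tailSup g C r c :=
  le_sup_left.trans (Finset.le_sup (f := fun d => g (idx C d) ⊔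
    (tail_finite C c).toFinset.sup fun e => r e d) ((tail_finite C c).mem_toFinset.2 hd))

theorem le_tailSup {g : Ordinal.{u} → B} {C : Set Ordinal.{u}}
    {r : Ordinal.{u} → Ordinal.{u} → B} {c d e : Ordinal.{u}} (hd : d ∈ tail C c)
    (he : e ∈ tail C c) : r e d ≤ tailSup g C r c :=
  (Finset.le_sup (f := fun e => r e d) ((tail_finite C c).mem_toFinset.2 he)).trans <|
    le_sup_right.trans (Finset.le_sup (f := fun d => g (idx C d) ⊔
      (tail_finite C c).toFinset.sup fun e => r e d) ((tail_finite C c).mem_toFinset.2 hd))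

theorem tailSup_le {g : Ordinal.{u} → B} {C : Set Ordinal.{u}}
    {r : Ordinal.{u} → Ordinal.{u} → B} {c : Ordinal.{u}} {b : B}
    (h₁ : ∀ d ∈ tail C c, g (idx C d) ≤ b) (h₂ : ∀ d ∈ tail C c, ∀ e ∈ tail C c, r e d ≤ b) :
    tailSup g C r c ≤ b :=
  Finset.sup_le fun d hd => sup_le (h₁ d ((tail_finite C c).mem_toFinset.1 hd)) <|
    Finset.sup_le fun e he =>
      h₂ d ((tail_finite C c).mem_toFinset.1 hd) e ((tail_finite C c).mem_toFinset.1 he)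

theorem tailSup_mono {g : Ordinal.{u} → B} {C : Set Ordinal.{u}}
    {r : Ordinal.{u} → Ordinal.{u} → B} {c d : Ordinal.{u}} (hd : d ∈ tail C c) :
    tailSup g C r d ≤ tailSup g C r c :=
  tailSup_le (fun _ he => idx_le_tailSup (tail_subset hd he))
    fun _ he _ he' => le_tailSup (tail_subset hd he) (tail_subset hd he')

theorem tailSup_congr {g : Ordinal.{u} → B} {C C' : Set Ordinal.{u}}
    {r r' : Ordinal.{u} → Ordinal.{u} → B} {c : Ordinal.{u}} (ht : tail C c = tail C' c)
    (hi : ∀ d ≤ c, idx C d = idx C' d) (hr : ∀ d ≤ c, ∀ e, r e d = r' e d) :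
    tailSup g C r c = tailSup g C' r' c := by
  apply le_antisymm
  · refine tailSup_le (fun d hd => ?_) fun d hd e he => ?_
    · rw [hi d hd.2.1]
      exact idx_le_tailSup (ht ▸ hd)
    · rw [hr d hd.2.1]
      exact le_tailSup (ht ▸ hd) (ht ▸ he)
  · refine tailSup_le (fun d hd => ?_) fun d hd e he => ?_
    · rw [← hi d hd.2.1]
      exact idx_le_tailSup (ht ▸ hd)
    · rw [← hr d hd.2.1]
      exact le_tailSup (ht ▸ hd) (ht ▸ he)

theorem tailSup_of_tail_eq_singleton {g : Ordinal.{u} → B} {C : Set Ordinal.{u}}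
    {r : Ordinal.{u} → Ordinal.{u} → B} {c : Ordinal.{u}} (h : tail C c = {c}) (hr : r c c = ⊥) :
    tailSup g C r c = g (idx C c) := by
  apply le_antisymm
  · refine tailSup_le (fun d hd => ?_) fun d hd e he => ?_
    · rw [h] at hd
      rw [hd]
    · rw [h] at hd he
      rw [hd, he, hr]
      exact bot_le
  · exact idx_le_tailSup (h ▸ rfl)

open Classical in
/-- The distance function obtained by walking down from `β` to `α` along `C`, with values in
`B`. -/
noncomputable def walk (g : Ordinal.{u} → B) (C : Ordinal.{u} → Set Ordinal.{u})
    (α β : Ordinal.{u}) : B :=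
  (WellFounded.fix (C := fun _ => Ordinal.{u} → B) Ordinal.lt_wf fun β r α =>
    if α < β then
      tailSup g (C β) (fun e d => if h : d < β then r d h e else ⊥) (next (C β) α) ⊔
        (if h : next (C β) α < β then r (next (C β) α) h α else ⊥)
    else ⊥) β α

theorem walk_of_le {g : Ordinal.{u} → B} {C : Ordinal.{u} → Set Ordinal.{u}}
    {α β : Ordinal.{u}} (h : β ≤ α) : walk g C α β = ⊥ := by
  rw [walk, WellFounded.fix_eq, if_neg (not_lt.2 h)]

variable {g : Ordinal.{u} → B} {C : Ordinal.{u} → Set Ordinal.{u}} {o δ : Ordinal.{u}}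

theorem IsCoherentSeq.next_mem (hC : IsCoherentSeq o δ C) {α β : Ordinal.{u}} (hβ : β < δ)
    (h : α < β) : next (C β) α ∈ C β :=
  (Ladder.next_mem (hC.cofinal hβ h)).1

theorem IsCoherentSeq.le_next (hC : IsCoherentSeq o δ C) {α β : Ordinal.{u}} (hβ : β < δ)
    (h : α < β) : α ≤ next (C β) α :=
  (Ladder.next_mem (hC.cofinal hβ h)).2

theorem IsCoherentSeq.next_lt (hC : IsCoherentSeq o δ C) {α β : Ordinal.{u}} (hβ : β < δ)
    (h : α < β) : next (C β) α < β :=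
  hC.lt hβ (hC.next_mem hβ h)

theorem walk_of_lt (hC : IsCoherentSeq o δ C) {α β : Ordinal.{u}} (hβ : β < δ) (h : α < β) :
    walk g C α β =
      tailSup g (C β) (walk g C) (next (C β) α) ⊔ walk g C α (next (C β) α) := by
  have hn := hC.next_lt hβ h
  rw [walk, WellFounded.fix_eq, if_pos h, dif_pos hn]
  congr 1
  refine tailSup_congr rfl (fun _ _ => rfl) fun d hd e => ?_
  rw [dif_pos (hd.trans_lt hn)]
  rfl

/-- Walks from `β` and from a limit point of `C β` agree. -/
theorem walk_eq_of_isLimitPoint (hC : IsCoherentSeq o δ C) {α l β : Ordinal.{u}} (hβ : β < δ)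
    (hlβ : l ≤ β) (hl : IsLimitPoint l (C β)) (h : α < l) : walk g C α l = walk g C α β := by
  have hlδ := hlβ.trans_lt hβ
  have hCl := hC.coherent hβ hl
  have hn := hC.next_lt hlδ h
  have hm := hC.next_mem hlδ h
  -- `C l` is an initial segment of `C β` unbounded in `l`, so the first step below `l`, its tail
  -- and its indices are the same for both.
  have hnext : next (C β) α = next (C l) α := by
    refine next_eq ?_ (hC.le_next hlδ h) fun d hd hαd => ?_
    · rw [hCl] at hm ⊢
      exact hm.1
    · rcases lt_or_ge d l with hdl | hdl
      · exact next_le (by rw [hCl]; exact ⟨hd, hdl⟩) hαd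
      · exact hn.le.trans hdl
  rw [walk_of_lt hC hlδ h, walk_of_lt hC hβ (h.trans_le hlβ), hnext]
  congr 1
  refine tailSup_congr ?_ (fun d hd => ?_) fun _ _ _ => rfl
  · rw [hCl] at hn ⊢
    exact tail_inter_Iio hn
  · rw [hCl] at hn hd ⊢
    exact idx_inter_Iio (hd.trans hn.le)

theorem tailSup_walk_of_isLimitPoint {D : Set Ordinal.{u}} {c : Ordinal.{u}} (hc : c ∈ D)
    (h : IsLimitPoint c D) : tailSup g D (walk g C) c = g (idx D c) :=
  tailSup_of_tail_eq_singleton (tail_eq_singleton hc h) (walk_of_le le_rfl)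

/-- Every step goes to the minimum of `C β`, which has index `0` and is alone in its tail. -/
theorem walk_zero (hg : g 0 = ⊥) (hC : IsCoherentSeq o δ C) {β : Ordinal.{u}} (hβ : β < δ) :
    walk g C 0 β = ⊥ := by
  induction β using WellFoundedLT.induction with
  | ind β ih =>
    rcases eq_or_ne β 0 with rfl | h0
    · exact walk_of_le le_rfl
    have hpos := pos_iff_ne_zero.2 h0
    have hle : ∀ d ∈ C β, next (C β) 0 ≤ d := fun d hd => next_le hd zero_le
    have hn := hC.next_lt hβ hpos
    rw [walk_of_lt hC hβ hpos, ih _ hn (hn.trans hβ), sup_bot_eq,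
      tailSup_of_tail_eq_singleton
        (tail_eq_singleton_of_forall_le (hC.next_mem hβ hpos) hle) (walk_of_le le_rfl),
      idx_eq_zero hle, hg]

/-- Let `c ≤ c'` be the first steps towards `α ≤ α'`. If `α' ≤ c` the steps coincide and induction
applies. Otherwise induction below `c'` is applied to an intermediate point of the tail of `c'`,
whose distance to `c'` is part of the cost of the step to `c'`. -/
theorem walk_subadditive (hC : IsCoherentSeq o δ C) {β : Ordinal.{u}} (hβ : β < δ) :
    ∀ {α α' : Ordinal.{u}}, α ≤ α' → α' ≤ β →
      walk g C α β ≤ walk g C α α' ⊔ walk g C α' β ∧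
      walk g C α α' ≤ walk g C α β ⊔ walk g C α' β := by
  induction β using WellFoundedLT.induction with
  | ind β ih =>
    intro α α' hα hα'
    rcases hα'.eq_or_lt with rfl | hα'β
    · exact ⟨le_sup_left, le_sup_left⟩
    rcases hα.eq_or_lt with rfl | hαα'
    · exact ⟨le_sup_right, (walk_of_le le_rfl).trans_le bot_le⟩
    have hαβ := hαα'.trans hα'β
    have e₁ := walk_of_lt (g := g) hC hβ hαβ
    have e₂ := walk_of_lt (g := g) hC hβ hα'β
    have hcm := hC.next_mem hβ hαβ
    have hcm' := hC.next_mem hβ hα'β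
    have hαc := hC.le_next hβ hαβ
    have hαc' := hC.le_next hβ hα'β
    have hcβ := hC.next_lt hβ hαβ
    have hcβ' := hC.next_lt hβ hα'β
    have hcc' : next (C β) α ≤ next (C β) α' := next_le hcm' (hα.trans hαc')
    have hcc : α' ≤ next (C β) α → next (C β) α' = next (C β) α := fun h =>
      le_antisymm (next_le hcm h) hcc'
    generalize hc : next (C β) α = c at *
    generalize hc' : next (C β) α' = c' at *
    have hIH := @ih c' hcβ' (hcβ'.trans hβ)
    obtain ⟨i₁, i₂⟩ := hIH hα hαc'
    have hH : walk g C α' c' ≤ walk g C α' β := e₂ ▸ le_sup_right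
    have hT : tailSup g (C β) (walk g C) c' ≤ walk g C α' β := e₂ ▸ le_sup_left
    rcases le_or_gt α' c with hle | hlt
    · obtain rfl := hcc hle
      constructor
      · rw [e₁]
        exact sup_le (hT.trans le_sup_right) (i₁.trans (sup_le_sup_left hH _))
      · exact i₂.trans (sup_le_sup (e₁ ▸ le_sup_right) hH)
    -- The intermediate point `l` is `c` itself when `c` is in the tail of `c'`, and otherwise a
    -- limit point of `C β` above `c`, where coherence gives equality of the distances from `α`.
    have key : ∀ l ∈ tail (C β) c', α ≤ l → walk g C α l ≤ walk g C α β →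
        (walk g C α α' ≤ walk g C α β ⊔ walk g C α' β ∧
          walk g C α l ≤ walk g C α α' ⊔ walk g C α' β) := by
      intro l hl hαl hle
      obtain ⟨j₁, j₂⟩ := hIH hαl hl.2.1
      have hlc' : walk g C l c' ≤ walk g C α' β := (le_tailSup (self_mem_tail hcm') hl).trans hT
      refine ⟨i₂.trans (sup_le (j₁.trans (sup_le_sup hle hlc')) (hH.trans le_sup_right)),
        j₂.trans (sup_le (i₁.trans (sup_le_sup_left hH _)) (hlc'.trans le_sup_right))⟩
    by_cases hct : c ∈ tail (C β) c'
    · obtain ⟨k₁, k₂⟩ := key c hct hαc (e₁ ▸ le_sup_right)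
      exact ⟨e₁ ▸ sup_le (((tailSup_mono hct).trans hT).trans le_sup_right) k₂, k₁⟩
    · obtain ⟨l, hl, hcl, hlim⟩ :=
        exists_isLimitPoint_mem_tail (hC.closed hβ) hcβ' hcm hcc' hct
      have heq := walk_eq_of_isLimitPoint (g := g) hC hβ (hl.2.1.trans hcβ'.le) hlim
        (hαc.trans_lt hcl)
      obtain ⟨k₁, k₂⟩ := key l hl (hαc.trans hcl.le) heq.le
      exact ⟨heq ▸ k₂, k₁⟩

/-- If `α` is a limit point of `C β`, its distance to `β` is just its coded index, a limit of
indices of first steps, and closedness of the indexing applies. If not, the first step is constant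
on a final segment below `α`, and induction applies to that step. -/
theorem isClosedIn_D_walk (hg : IsIndexing o g) (hC : IsCoherentSeq o δ C) {β : Ordinal.{u}}
    (hβ : β < δ) (p : B) : IsClosedIn (D (walk g C) β p) β := by
  induction β using WellFoundedLT.induction with
  | ind β ih =>
    intro α hαβ hα
    refine ⟨hαβ, ?_⟩
    have hle : ∀ η ∈ D (walk g C) β p, g (idx (C β) (next (C β) η)) ≤ p ∧
        tailSup g (C β) (walk g C) (next (C β) η) ≤ p ∧ walk g C η (next (C β) η) ≤ p := by
      rintro η ⟨hη, hp⟩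
      rw [walk_of_lt hC hβ hη] at hp
      exact ⟨(idx_le_tailSup (self_mem_tail (hC.next_mem hβ hη))).trans (le_sup_left.trans hp),
        le_sup_left.trans hp, le_sup_right.trans hp⟩
    by_cases hlim : IsLimitPoint α (C β)
    · have hmem := hC.closed hβ α hαβ hlim
      have hnext : next (C β) α = α := next_eq hmem le_rfl fun _ _ h => h
      rw [walk_of_lt hC hβ hαβ, hnext, walk_of_le le_rfl, sup_bot_eq,
        tailSup_walk_of_isLimitPoint hmem hlim]
      refine (hg.closed p _ (hC.idx_lt hβ hmem) ⟨?_, fun i hi => ?_⟩).2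
      · obtain ⟨e, he, -, heα⟩ := hlim.2 0 (pos_iff_ne_zero.2 hlim.1)
        exact (zero_le.trans_lt (idx_lt_idx he heα)).ne'
      -- The step from a point `η` of `D` above `e` has index beyond `i`, and it stays below `α`
      -- because `C β` is unbounded in `α`.
      · obtain ⟨e, he, heα, hie⟩ := exists_le_idx hi
        obtain ⟨η, hη, heη, hηα⟩ := hα.2 e heα
        obtain ⟨e', he', hηe', heα'⟩ := hlim.2 η hηα
        have hm := hC.next_mem hβ hη.1
        exact ⟨_, ⟨hC.idx_lt hβ hm, (hle η hη).1⟩,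
          hie.trans_lt (idx_lt_idx he (heη.trans_le (hC.le_next hβ hη.1))),
          idx_lt_idx hm ((next_le he' hηe'.le).trans_lt heα')⟩
    · have : ∃ ε < α, ∀ η ∈ C β, ε < η → α ≤ η := by
        by_contra! h
        exact hlim ⟨hα.1, h⟩
      obtain ⟨ε, hε, hεC⟩ := this
      have hnext : ∀ η ∈ D (walk g C) β p, ε < η → η < α → next (C β) η = next (C β) α := by
        intro η hη hεη hηα
        refine next_eq (hC.next_mem hβ hαβ) (hηα.le.trans (hC.le_next hβ hαβ)) ?_
        exact fun d hd hηd => next_le hd (hεC d hd (hεη.trans_le hηd))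
      rw [walk_of_lt hC hβ hαβ]
      refine sup_le ?_ ?_
      · obtain ⟨η, hη, hεη, hηα⟩ := hα.2 ε hε
        exact hnext η hη hεη hηα ▸ (hle η hη).2.1
      · rcases (hC.le_next hβ hαβ).eq_or_lt with heq | hlt
        · rw [walk_of_le heq.ge]
          exact bot_le
        · have hc := hC.next_lt hβ hαβ
          refine (ih _ hc (hc.trans hβ) α hlt ⟨hα.1, fun ζ hζ => ?_⟩).2
          obtain ⟨η, hη, h₁, hηα⟩ := hα.2 (max ζ ε) (max_lt hζ hε)
          have := (hle η hη).2.2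
          rw [hnext η hη ((le_max_right _ _).trans_lt h₁) hηα] at this
          exact ⟨η, ⟨hηα.trans hlt, this⟩, (le_max_left _ _).trans_lt h₁, hηα⟩

theorem D_walk_subset (hC : IsCoherentSeq o δ C) {β : Ordinal.{u}} (hβ : β < δ) (p : B) :
    D (walk g C) β p ⊆ ⋃ c ∈ {c | c ∈ C β ∧ g (idx (C β) c) ≤ p}, insert c (D (walk g C) c p) := by
  rintro η ⟨hη, hp⟩
  rw [walk_of_lt hC hβ hη] at hp
  have hm := hC.next_mem hβ hη
  refine Set.mem_biUnion
    ⟨hm, (idx_le_tailSup (self_mem_tail hm)).trans (le_sup_left.trans hp)⟩ ?_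
  rcases (hC.le_next hβ hη).eq_or_lt with h | h
  · exact Or.inl h
  · exact Or.inr ⟨h, le_sup_right.trans hp⟩

theorem injOn_idx (hg : IsIndexing o g) (hC : IsCoherentSeq o δ C) {β : Ordinal.{u}}
    (hβ : β < δ) : Set.InjOn (fun c => g (idx (C β) c)) (C β) := by
  intro c hc d hd h
  have := hg.injOn (hC.idx_lt hβ hc) (hC.idx_lt hβ hd) h
  rcases lt_trichotomy c d with hlt | heq | hlt
  · exact absurd this (idx_lt_idx hc hlt).ne
  · exact heq
  · exact absurd this (idx_lt_idx hd hlt).ne'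

/-- Kept apart from the cardinal bound below, whose `ℵ₀` is too large when `κ = ℵ₀`: here the
branching is finite and the walks descend. -/
theorem finite_D_walk (hg : IsIndexing o g) (hC : IsCoherentSeq o δ C) {p : B}
    (hp : (Set.Iic p).Finite) {β : Ordinal.{u}} (hβ : β < δ) : (D (walk g C) β p).Finite := by
  induction β using WellFoundedLT.induction with
  | ind β ih =>
    refine Set.Finite.subset (Set.Finite.biUnion ?_ fun c hc => ?_) (D_walk_subset hC hβ p)
    · exact Set.Finite.of_finite_image (hp.subset (Set.image_subset_iff.2 fun c hc => hc.2))
        ((injOn_idx hg hC hβ).mono fun c hc => hc.1)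
    · have := hC.lt hβ hc.1
      exact (ih c this (this.trans hβ)).insert c

theorem mk_D_walk_le (hg : IsIndexing o g) (hC : IsCoherentSeq o δ C) {p : B} {β : Ordinal.{u}}
    (hβ : β < δ) : #(D (walk g C) β p) ≤ lift.{u + 1} (max ℵ₀ #(Set.Iic p)) := by
  have hinf : ℵ₀ ≤ lift.{u + 1} (max ℵ₀ #(Set.Iic p)) :=
    aleph0_le_lift.2 (le_max_left _ _)
  induction β using WellFoundedLT.induction with
  | ind β ih =>
    refine (mk_le_mk_of_subset (D_walk_subset hC hβ p)).trans ((mk_biUnion_le _ _).trans ?_)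
    refine mul_le_of_le hinf ?_ (ciSup_le' fun c => ?_)
    · refine le_trans ?_ (lift_le.2 (le_max_right _ _))
      let f : {c | c ∈ C β ∧ g (idx (C β) c) ≤ p} → Set.Iic p := fun c => ⟨_, c.2.2⟩
      have hf : Function.Injective f := fun c d h =>
        Subtype.ext (injOn_idx hg hC hβ c.2.1 d.2.1 (congrArg Subtype.val h))
      have := lift_mk_le_lift_mk_of_injective hf
      rwa [lift_id'.{u, u + 1}] at this
    · have := hC.lt hβ c.2.1
      exact mk_insert_le.trans
        (add_le_of_le hinf (ih c this (this.trans hβ)) (one_le_aleph0.trans hinf))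

theorem mk_D_walk_lt {κ : Cardinal.{u}} (hκ : ℵ₀ ≤ κ) (hg : IsIndexing o g)
    (hC : IsCoherentSeq o δ C) {p : B} (hp : #(Set.Iic p) < κ) {β : Ordinal.{u}} (hβ : β < δ) :
    #(D (walk g C) β p) < lift.{u + 1} κ := by
  rcases (Set.Iic p).finite_or_infinite with h | h
  · exact (finite_D_walk hg hC h hβ).lt_aleph0.trans_le (aleph0_le_lift.2 hκ)
  · refine (mk_D_walk_le hg hC hβ).trans_lt (lift_lt.2 (max_lt ?_ hp))
    exact (infinite_iff.1 h.to_subtype).trans_lt hp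

end Walk

/-! ### From subadditive maps to lattices and ladders. -/

theorem exists_lattice_of_equiv {P : Type u} {X : Type v} (e : P ≃ X) {r : X → X → Prop}
    (refl : ∀ x, r x x) (trans : ∀ x y z, r x y → r y z → r x z)
    (antisymm : ∀ x y, r x y → r y x → x = y)
    (lub : ∀ x y, ∃ z, r x z ∧ r y z ∧ ∀ w, r x w → r y w → r z w)
    (glb : ∀ x y, ∃ z, r z x ∧ r z y ∧ ∀ w, r w x → r w y → r w z) :
    ∃ _ : Lattice P, ∀ x y : P, x ≤ y ↔ r (e x) (e y) := by
  choose s hs₁ hs₂ hs₃ using lub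
  choose i hi₁ hi₂ hi₃ using glb
  refine ⟨{
    le := fun x y => r (e x) (e y)
    le_refl := fun x => refl _
    le_trans := fun x y z => trans _ _ _
    le_antisymm := fun x y h h' => e.injective (antisymm _ _ h h')
    sup := fun x y => e.symm (s (e x) (e y))
    inf := fun x y => e.symm (i (e x) (e y))
    le_sup_left := fun x y => ?_
    le_sup_right := fun x y => ?_
    sup_le := fun x y z h h' => ?_
    inf_le_left := fun x y => ?_
    inf_le_right := fun x y => ?_
    le_inf := fun x y z h h' => ?_ }, fun x y => Iff.rfl⟩
  · rw [e.apply_symm_apply]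
    exact hs₁ _ _
  · rw [e.apply_symm_apply]
    exact hs₂ _ _
  · rw [e.apply_symm_apply]
    exact hs₃ _ _ _ h h'
  · rw [e.apply_symm_apply]
    exact hi₁ _ _
  · rw [e.apply_symm_apply]
    exact hi₂ _ _
  · rw [e.apply_symm_apply]
    exact hi₃ _ _ _ h h'

/-- The conditions on `ρ` that turn `(γ × B, ⊴_ρ)` into a lattice with principal ideals of
cardinality `< κ`. -/
structure IsLadderMap {B : Type u} [Lattice B] [OrderBot B] (κ : Cardinal.{u}) (γ : Ordinal.{u})
    (ρ : Ordinal.{u} → Ordinal.{u} → B) : Prop where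
  diag : ∀ α < γ, ρ α α = ⊥
  zero : ∀ α < γ, ρ 0 α = ⊥
  le_sup : ∀ {η α β}, η ≤ α → α ≤ β → β < γ → ρ η β ≤ ρ η α ⊔ ρ α β
  le_sup' : ∀ {η α β}, η ≤ α → α ≤ β → β < γ → ρ η α ≤ ρ η β ⊔ ρ α β
  closed : ∀ α < γ, ∀ p : B, IsClosedIn (D ρ α p) α
  mk_lt : ∀ α < γ, ∀ p : B, #(D ρ α p) < lift.{u + 1} κ

theorem TriLE.antisymm {B : Type u} [Lattice B] {γ : Ordinal.{u}}
    {ρ : Ordinal.{u} → Ordinal.{u} → B} {x y : Set.Iio γ × B} (hxy : TriLE γ ρ x y)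
    (hyx : TriLE γ ρ y x) : x = y :=
  Prod.ext (le_antisymm hxy.1 hyx.1)
    (le_antisymm (sup_le_iff.1 hxy.2).1 (sup_le_iff.1 hyx.2).1)

section Presentation

variable {B : Type u} [Lattice B] [OrderBot B] {κ : Cardinal.{u}} {γ : Ordinal.{u}}
  {ρ : Ordinal.{u} → Ordinal.{u} → B}

theorem csSup_mem_or_isLimitPoint {S : Set Ordinal.{u}} (h0 : 0 ∈ S) (hb : BddAbove S) :
    sSup S ∈ S ∨ IsLimitPoint (sSup S) S := by
  by_cases h : sSup S ∈ S
  · exact Or.inl h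
  · refine Or.inr ⟨fun hs => h (hs ▸ h0), fun δ hδ => ?_⟩
    obtain ⟨η, hη, h'⟩ := exists_lt_of_lt_csSup ⟨0, h0⟩ hδ
    exact ⟨η, hη, h', (le_csSup hb hη).lt_of_ne fun he => h (he ▸ hη)⟩

namespace IsLadderMap

theorem refl (h : IsLadderMap κ γ ρ) (x : Set.Iio γ × B) : TriLE γ ρ x x :=
  ⟨le_rfl, by rw [h.diag _ x.1.2, sup_bot_eq]⟩

theorem trans (h : IsLadderMap κ γ ρ) (x y z : Set.Iio γ × B) (hxy : TriLE γ ρ x y)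
    (hyz : TriLE γ ρ y z) : TriLE γ ρ x z :=
  have h₁ := sup_le_iff.1 hxy.2
  have h₂ := sup_le_iff.1 hyz.2
  ⟨hxy.1.trans hyz.1, sup_le (h₁.1.trans h₂.1)
    ((h.le_sup hxy.1 hyz.1 z.1.2).trans (sup_le (h₁.2.trans h₂.1) h₂.2))⟩

theorem lub_of_le (h : IsLadderMap κ γ ρ) {x y : Set.Iio γ × B} (hxy : x.1 ≤ y.1) :
    TriLE γ ρ x (y.1, x.2 ⊔ y.2 ⊔ ρ x.1 y.1) ∧ TriLE γ ρ y (y.1, x.2 ⊔ y.2 ⊔ ρ x.1 y.1) ∧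
      ∀ w, TriLE γ ρ x w → TriLE γ ρ y w → TriLE γ ρ (y.1, x.2 ⊔ y.2 ⊔ ρ x.1 y.1) w := by
  refine ⟨⟨hxy, sup_le_sup_right le_sup_left _⟩, ⟨le_rfl, ?_⟩, fun w hx hy => ⟨hy.1, ?_⟩⟩
  · rw [h.diag _ y.1.2, sup_bot_eq]
    exact le_sup_right.trans le_sup_left
  · have h₁ := sup_le_iff.1 hx.2
    have h₂ := sup_le_iff.1 hy.2
    exact sup_le (sup_le (sup_le h₁.1 h₂.1)
      ((h.le_sup' hxy hy.1 w.1.2).trans (sup_le h₁.2 h₂.2))) h₂.2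

theorem exists_lub (h : IsLadderMap κ γ ρ) (x y : Set.Iio γ × B) :
    ∃ z, TriLE γ ρ x z ∧ TriLE γ ρ y z ∧ ∀ w, TriLE γ ρ x w → TriLE γ ρ y w → TriLE γ ρ z w := by
  rcases le_total x.1 y.1 with hxy | hxy
  · exact ⟨_, h.lub_of_le hxy⟩
  · obtain ⟨h₁, h₂, h₃⟩ := h.lub_of_le hxy
    exact ⟨_, h₂, h₁, fun w hx hy => h₃ w hy hx⟩

/-- The first coordinate of the meet is the largest `η` admissible for both `x` and `y`: `0` is
admissible, and closedness of `D` makes the supremum admissible. -/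
theorem exists_glb (h : IsLadderMap κ γ ρ) (x y : Set.Iio γ × B) :
    ∃ z, TriLE γ ρ z x ∧ TriLE γ ρ z y ∧ ∀ w, TriLE γ ρ w x → TriLE γ ρ w y → TriLE γ ρ w z := by
  let T (x : Set.Iio γ × B) : Set Ordinal.{u} := {η | η ≤ x.1 ∧ ρ η x.1 ≤ x.2}
  have h0T : ∀ x, 0 ∈ T x := fun x => ⟨zero_le, by rw [h.zero _ x.1.2]; exact bot_le⟩
  let S := T x ∩ T y
  have h0 : 0 ∈ S := ⟨h0T x, h0T y⟩
  have hb : BddAbove S := ⟨x.1, fun η hη => hη.1.1⟩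
  have hT : ∀ x, S ⊆ T x → sSup S ∈ T x := by
    intro x hS
    have hle : sSup S ≤ x.1 := csSup_le ⟨0, h0⟩ fun η hη => (hS hη).1
    rcases csSup_mem_or_isLimitPoint h0 hb with hm | hlim
    · exact hS hm
    rcases hle.eq_or_lt with heq | hlt
    · rw [heq]
      exact ⟨le_rfl, by rw [h.diag _ x.1.2]; exact bot_le⟩
    · refine ⟨hle, (h.closed _ x.1.2 x.2 _ hlt ⟨hlim.1, fun δ hδ => ?_⟩).2⟩
      obtain ⟨η, hη, h₁, h₂⟩ := hlim.2 δ hδ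
      exact ⟨η, ⟨h₂.trans hlt, (hS hη).2⟩, h₁, h₂⟩
  have hx := hT x Set.inter_subset_left
  have hy := hT y Set.inter_subset_right
  refine ⟨(⟨sSup S, hx.1.trans_lt x.1.2⟩, x.2 ⊓ y.2), ⟨hx.1, sup_le inf_le_left hx.2⟩,
    ⟨hy.1, sup_le inf_le_right hy.2⟩, fun w hwx hwy => ?_⟩
  have h₁ := sup_le_iff.1 hwx.2
  have h₂ := sup_le_iff.1 hwy.2
  have hw : w.1.1 ≤ sSup S := le_csSup hb ⟨⟨hwx.1, h₁.2⟩, hwy.1, h₂.2⟩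
  exact ⟨hw, sup_le (le_inf h₁.1 h₂.1) (le_inf
    ((h.le_sup' hw hx.1 x.1.2).trans (sup_le h₁.2 hx.2))
    ((h.le_sup' hw hy.1 y.1.2).trans (sup_le h₂.2 hy.2)))⟩

theorem exists_isPresentedBy (h : IsLadderMap κ γ ρ) :
    ∃ (P : Type u) (_ : Lattice P), IsPresentedBy P γ B ρ := by
  -- `Set.Iio γ` lives one universe up, so the carrier is shrunk.
  let e : Shrink.{u} (Set.Iio γ × B) ≃ Set.Iio γ × B := (equivShrink _).symm
  obtain ⟨i, hi⟩ := exists_lattice_of_equiv e h.refl h.trans (fun _ _ => TriLE.antisymm)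
    h.exists_lub h.exists_glb
  exact ⟨_, i, h.diag, h.zero, e, hi⟩

variable {P : Type u} [Lattice P] {e : P ≃ Set.Iio γ × B}

theorem apply_sup (h : IsLadderMap κ γ ρ) (he : ∀ x y, x ≤ y ↔ TriLE γ ρ (e x) (e y)) {x y : P}
    (hxy : (e x).1 ≤ (e y).1) :
    e (x ⊔ y) = ((e y).1, (e x).2 ⊔ (e y).2 ⊔ ρ (e x).1 (e y).1) := by
  obtain ⟨h₁, h₂, h₃⟩ := h.lub_of_le hxy
  refine TriLE.antisymm (ρ := ρ) ?_ (h₃ _ ((he _ _).1 le_sup_left) ((he _ _).1 le_sup_right))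
  have := (he (x ⊔ y) (e.symm ((e y).1, (e x).2 ⊔ (e y).2 ⊔ ρ (e x).1 (e y).1))).1
    (sup_le ((he _ _).2 (by rwa [e.apply_symm_apply]))
      ((he _ _).2 (by rwa [e.apply_symm_apply])))
  rwa [e.apply_symm_apply] at this

theorem fst_sup (h : IsLadderMap κ γ ρ) (he : ∀ x y, x ≤ y ↔ TriLE γ ρ (e x) (e y)) (x y : P) :
    (e (x ⊔ y)).1 = max (e x).1 (e y).1 := by
  rcases le_total (e x).1 (e y).1 with hxy | hxy
  · rw [h.apply_sup he hxy, max_eq_right hxy]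
  · rw [sup_comm, h.apply_sup he hxy, max_eq_left hxy]

theorem snd_sup (h : IsLadderMap κ γ ρ) (he : ∀ x y, x ≤ y ↔ TriLE γ ρ (e x) (e y)) {x y : P}
    (hxy : (e x).1 = (e y).1) : (e (x ⊔ y)).2 = (e x).2 ⊔ (e y).2 := by
  rw [h.apply_sup he hxy.le, hxy, h.diag _ (e y).1.2, sup_bot_eq]

end IsLadderMap

/-- The embedding of `M̄_X` into `M̄_Y` induced by an injection of `X` into `Y`. -/
def MBar.map {X Y : Type*} (φ : X → Y) : MBar X → MBar Y
  | .atom x => .atom (φ x)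
  | .one => .one

theorem MBar.map_injective {X Y : Type*} {φ : X → Y} (hφ : Function.Injective φ) :
    Function.Injective (MBar.map φ) := by
  rintro (x | _) (y | _) h
  · exact congrArg _ (hφ (MBar.atom.inj h))
  · cases h
  · cases h
  · rfl

theorem MBar.map_sup {X Y : Type*} {φ : X → Y} (hφ : Function.Injective φ) (x y : MBar X) :
    MBar.map φ (x ⊔ y) = MBar.map φ x ⊔ MBar.map φ y := by
  by_cases h : x = y
  · rw [h, MBar.sup_self, MBar.sup_self]
  · rw [MBar.sup_of_ne h, MBar.sup_of_ne ((MBar.map_injective hφ).ne h)]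
    rfl

variable {P : Type u} [Lattice P]

theorem IsLadderMap.mBarFree (h : IsLadderMap κ γ ρ) (hP : IsPresentedBy P γ B ρ) {k : ℕ}
    (hB : MBarFree k B) : MBarFree (k + 1) P := by
  obtain ⟨-, -, e, he⟩ := hP
  rintro ⟨f, hf⟩
  have hle : ∀ x, (e (f x)).1 ≤ (e (f .one)).1 := by
    intro x
    rw [← MBar.sup_one x, map_sup, h.fst_sup he]
    exact le_max_left _ _
  -- The first coordinate of the top is the maximum of those of any two distinct atoms, so at most
  -- one atom falls below it.
  have hmax : ∀ i j : Fin (k + 1), i ≠ j → (e (f (.atom i))).1 ≠ (e (f .one)).1 →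
      (e (f (.atom j))).1 = (e (f .one)).1 := by
    intro i j hij hi
    have := h.fst_sup he (f (.atom i)) (f (.atom j))
    rw [← map_sup, MBar.sup_of_ne fun h => hij (MBar.atom.inj h)] at this
    rcases max_choice (e (f (.atom i))).1 (e (f (.atom j))).1 with h' | h'
    · exact absurd (this.trans h').symm hi
    · exact (this.trans h').symm
  obtain ⟨i₀, hi₀⟩ : ∃ i₀ : Fin (k + 1), ∀ j ≠ i₀, (e (f (.atom j))).1 = (e (f .one)).1 := by
    by_cases hex : ∃ i : Fin (k + 1), (e (f (.atom i))).1 ≠ (e (f .one)).1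
    · obtain ⟨i, hi⟩ := hex
      exact ⟨i, fun j hj => hmax i j hj.symm hi⟩
    · push Not at hex
      exact ⟨0, fun j _ => hex j⟩
  have hφ := Fin.succAbove_right_injective (p := i₀)
  have hfst : ∀ x, (e (f (MBar.map i₀.succAbove x))).1 = (e (f .one)).1 := by
    rintro (x | _)
    · exact hi₀ _ (Fin.succAbove_ne i₀ x)
    · rfl
  refine hB ⟨⟨fun x => (e (f (MBar.map i₀.succAbove x))).2, fun x y => ?_⟩, fun x y hxy => ?_⟩
  · rw [MBar.map_sup hφ, map_sup, h.snd_sup he ((hfst x).trans (hfst y).symm)]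
  · exact MBar.map_injective hφ (hf (e.injective
      (Prod.ext ((hfst x).trans (hfst y).symm) hxy)))

/-- The ideal of `(α, p)` embeds in `(D ρ α p ∪ {α}) × Set.Iic p`. -/
theorem IsLadderMap.mk_Iic_lt (hκ : ℵ₀ ≤ κ) (h : IsLadderMap κ γ ρ)
    (hP : IsPresentedBy P γ B ρ) (hB : ∀ p : B, #(Set.Iic p) < κ) (x : P) :
    #(Set.Iic x) < κ := by
  obtain ⟨-, -, e, he⟩ := hP
  have hκ' : ℵ₀ ≤ lift.{u + 1} κ := aleph0_le_lift.2 hκ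
  let S : Set Ordinal.{u} := insert (e x).1.1 (D ρ (e x).1 (e x).2)
  have hS : #S < lift.{u + 1} κ :=
    mk_insert_le.trans_lt (add_lt_of_lt hκ' (h.mk_lt _ (e x).1.2 _) (one_lt_aleph0.trans_le hκ'))
  let f : Set.Iic x → S × Set.Iic (e x).2 := fun y =>
    have hy := (he _ _).1 y.2
    (⟨(e y).1, (hy.1.eq_or_lt).imp (congrArg Subtype.val)
      fun hlt => ⟨hlt, (sup_le_iff.1 hy.2).2⟩⟩, ⟨(e y).2, (sup_le_iff.1 hy.2).1⟩)
  have hf : Function.Injective f := by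
    intro y z hyz
    refine Subtype.ext (e.injective (Prod.ext (Subtype.ext ?_) ?_))
    · exact congrArg (fun t => t.1.1) hyz
    · exact congrArg (fun t => t.2.1) hyz
  have := lift_mk_le_lift_mk_of_injective hf
  rw [mk_prod, lift_id'.{u, u + 1}, lift_id'.{u, u + 1}] at this
  exact lift_lt.{u, u + 1}.1 (this.trans_lt (mul_lt_of_lt hκ' hS (lift_lt.2 (hB _))))

theorem IsPresentedBy.mk_eq (hP : IsPresentedBy P γ B ρ) : #P = γ.card * #B := by
  obtain ⟨-, -, e, he⟩ := hP
  have := lift_mk_eq'.2 ⟨e⟩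
  rw [mk_prod, mk_Iio_ordinal, lift_id'.{u, u + 1}, lift_id'.{u, u + 1},
    ← lift_mul] at this
  exact lift_injective this

/-- The indexing is `j ↦ (j, ⊥)`. Since `(j, ⊥) ⊴ (α, p)` means `j ≤ α` and `ρ j α ≤ p`, its
closedness is that of `D ρ α p`. -/
theorem IsLadderMap.exists_isIndexing (h : IsLadderMap κ γ ρ) (hP : IsPresentedBy P γ B ρ)
    (hγ : 0 < γ) : ∃ (_ : OrderBot P) (g : Ordinal.{u} → P), IsIndexing γ g := by
  classical
  obtain ⟨-, -, e, he⟩ := hP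
  let b : P := e.symm (⟨0, hγ⟩, ⊥)
  let i : OrderBot P :=
    { bot := b
      bot_le := fun x => (he _ _).2 (by
        rw [e.apply_symm_apply]
        exact ⟨zero_le (a := (e x).1.1), sup_le bot_le ((h.zero _ (e x).1.2).trans_le bot_le)⟩) }
  let g : Ordinal.{u} → P := fun j => if hj : j < γ then e.symm (⟨j, hj⟩, ⊥) else b
  have hg : ∀ j (hj : j < γ), g j = e.symm (⟨j, hj⟩, ⊥) := fun j hj => dif_pos hj
  have hle : ∀ j < γ, ∀ x, g j ≤ x ↔ j ≤ (e x).1 ∧ ρ j (e x).1 ≤ (e x).2 := by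
    intro j hj x
    rw [he, hg j hj, e.apply_symm_apply]
    change _ ∧ ⊥ ⊔ _ ≤ _ ↔ _
    rw [bot_sup_eq]
    rfl
  refine ⟨i, g, hg 0 hγ, fun j hj k hk hjk => ?_, fun x l hl hlim => ⟨hl, ?_⟩⟩
  · rw [hg j hj, hg k hk] at hjk
    exact congrArg (fun t => t.1.1) (e.symm.injective hjk)
  · rw [hle l hl]
    have hlx : l ≤ (e x).1 := by
      by_contra! hlt
      obtain ⟨j, ⟨hj, hjx⟩, h', -⟩ := hlim.2 _ hlt
      exact not_lt.2 ((hle j hj x).1 hjx).1 h'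
    refine ⟨hlx, ?_⟩
    rcases hlx.eq_or_lt with heq | hlt
    · rw [heq, h.diag _ (e x).1.2]
      exact bot_le
    · refine (h.closed _ (e x).1.2 (e x).2 l hlt ⟨hlim.1, fun δ hδ => ?_⟩).2
      obtain ⟨j, ⟨hj, hjx⟩, h₁, h₂⟩ := hlim.2 δ hδ
      exact ⟨j, ⟨h₂.trans hlt, ((hle j hj x).1 hjx).2⟩, h₁, h₂⟩

/-- The recursive step in the construction of special ladders. -/
theorem IsLadderMap.exists_ladder {ν : Cardinal.{u}} (hκ : ℵ₀ ≤ κ) (hν : ℵ₀ ≤ ν) {k : ℕ}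
    (hB : IsLadder k κ B) (hB' : IsSpecialLadder κ k B) (hBν : #B ≤ ν)
    (h : IsLadderMap κ ν.ord ρ) :
    ∃ (P : Type u) (_ : Lattice P) (_ : OrderBot P) (g : Ordinal.{u} → P),
      #P = ν ∧ IsLadder (k + 1) κ P ∧ IsSpecialLadder κ (k + 1) P ∧
      IsPresentedBy P ν.ord B ρ ∧ IsIndexing ν.ord g := by
  obtain ⟨P, _, hP⟩ := h.exists_isPresentedBy
  obtain ⟨hbot, g, hg⟩ := h.exists_isIndexing hP (Cardinal.isSuccLimit_ord hν).bot_lt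
  have hL : IsLadder (k + 1) κ P :=
    ⟨⟨⊥⟩, h.mBarFree hP hB.free, h.mk_Iic_lt hκ hP hB.card_Iic_lt⟩
  refine ⟨P, _, hbot, g, ?_, hL, ⟨hL, _, _, _, _, _, hB', hP⟩, hP, hg⟩
  rw [hP.mk_eq, card_ord]
  exact mul_eq_left hν hBν (mk_ne_zero_iff.2 hB.nonempty)

end Presentation

/-! ### The induction on `n`. -/

theorem isLadderMap_walk {B : Type u} [Lattice B] [OrderBot B] {κ : Cardinal.{u}}
    {o δ : Ordinal.{u}} {g : Ordinal.{u} → B} {C : Ordinal.{u} → Set Ordinal.{u}} (hκ : ℵ₀ ≤ κ)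
    (hg : IsIndexing o g) (hC : IsCoherentSeq o δ C) (hB : ∀ p : B, #(Set.Iic p) < κ) :
    IsLadderMap κ δ (walk g C) where
  diag _ _ := walk_of_le le_rfl
  zero _ h := walk_zero hg.zero hC h
  le_sup h₁ h₂ h := (walk_subadditive hC h h₁ h₂).1
  le_sup' h₁ h₂ h := (walk_subadditive hC h h₁ h₂).2
  closed _ h p := isClosedIn_D_walk hg hC h p
  mk_lt _ h p := mk_D_walk_lt hκ hg hC (hB p) h

/-- The base case: with `ρ` trivial, `D ρ α p` is `α` itself, which has fewer than `κ` elements. -/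
theorem isLadderMap_bot {B : Type u} [Lattice B] [OrderBot B] {κ : Cardinal.{u}} :
    IsLadderMap κ κ.ord (fun _ _ => (⊥ : B)) where
  diag _ _ := rfl
  zero _ _ := rfl
  le_sup _ _ _ := bot_le
  le_sup' _ _ _ := bot_le
  closed _ _ _ _ h _ := ⟨h, bot_le⟩
  mk_lt α hα p := by
    have : D (fun _ _ => (⊥ : B)) α p ⊆ Set.Iio α := fun _ h => h.1
    refine (mk_le_mk_of_subset this).trans_lt ?_
    rw [mk_Iio_ordinal, lift_lt]
    exact lt_ord.1 hα

theorem isLadder_zero_punit {κ : Cardinal.{u}} (hκ : ℵ₀ ≤ κ) : IsLadder 0 κ PUnit.{u + 1} where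
  nonempty := ⟨⟨⟩⟩
  free := by
    rintro ⟨f, hf⟩
    cases hf (Subsingleton.elim (f (.atom 0)) (f .one))
  card_Iic_lt _ := (mk_lt_aleph0 (α := Set.Iic _)).trans_le hκ

theorem aleph0_le_succIter {κ : Cardinal.{u}} (hκ : ℵ₀ ≤ κ) (n : ℕ) : ℵ₀ ≤ succIter κ n := by
  induction n with
  | zero => exact hκ
  | succ n ih =>
    rw [succIter, Function.iterate_succ_apply']
    exact ih.trans (Order.le_succ _)

/-- The indexing is carried through the induction; its length `κ^{+n}` matches the order type bound
in `□_{κ^{+n}}`, so it can code the indices at the next stage. -/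
theorem exists_special_ladder {κ : Cardinal.{u}} (hκ : ℵ₀ ≤ κ) (n : ℕ)
    (hsq : ∀ m < n, Square (succIter κ m)) :
    ∃ (P : Type u) (_ : Lattice P) (_ : OrderBot P) (g : Ordinal.{u} → P),
      #P = succIter κ n ∧ IsLadder (n + 1) κ P ∧ IsSpecialLadder κ (n + 1) P ∧
      (∃ (γ : Ordinal.{u}) (B : Type u) (_ : Lattice B) (_ : OrderBot B)
        (ρ : Ordinal.{u} → Ordinal.{u} → B),
        IsSpecialLadder κ n B ∧ IsPresentedBy P γ B ρ ∧
        ∀ α < γ, ∀ p : B, IsClosedIn (D ρ α p) α) ∧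
      IsIndexing (succIter κ n).ord g := by
  induction n with
  | zero =>
    have hB : IsSpecialLadder κ 0 PUnit.{u + 1} := ⟨⟨⟨⟩⟩, inferInstance⟩
    have h := isLadderMap_bot (B := PUnit.{u + 1}) (κ := κ)
    obtain ⟨P, i, j, g, h₁, h₂, h₃, h₄, h₅⟩ := h.exists_ladder hκ hκ
      (isLadder_zero_punit hκ) hB ((mk_lt_aleph0 (α := PUnit)).le.trans hκ)
    exact ⟨P, i, j, g, h₁, h₂, h₃, ⟨_, _, _, _, _, hB, h₄, h.closed⟩, h₅⟩
  | succ n ih =>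
    obtain ⟨B, _, _, g, hB, hL, hS, -, hg⟩ := ih fun m hm => hsq m (hm.trans (Nat.lt_succ_self n))
    have hinf := aleph0_le_succIter hκ n
    have hsucc : succIter κ (n + 1) = Order.succ (succIter κ n) :=
      Function.iterate_succ_apply' _ _ _
    obtain ⟨C, hC⟩ := (hsq n (Nat.lt_succ_self n)).exists_isCoherentSeq hinf
    rw [← hsucc] at hC
    have h := isLadderMap_walk hκ hg hC hL.card_Iic_lt
    obtain ⟨P, i, j, g', h₁, h₂, h₃, h₄, h₅⟩ := h.exists_ladder hκ
      (aleph0_le_succIter hκ (n + 1)) hL hS (by rw [hB, hsucc]; exact Order.le_succ _)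
    exact ⟨P, i, j, g', h₁, h₂, h₃, ⟨_, _, _, _, _, hS, h₄, h.closed⟩, h₅⟩

end Ladder

theorem theorem1p3 (κ : Cardinal.{u}) (hκ : ℵ₀ ≤ κ) (n : ℕ)
    (hsq : ∀ m < n, Ladder.Square (Ladder.succIter κ m)) :
    ∃ (P : Type u) (_ : Lattice P),
      #P = Ladder.succIter κ n ∧
      Ladder.IsLadder (n + 1) κ P ∧
      Ladder.IsSpecialLadder κ (n + 1) P ∧
      ∃ (γ : Ordinal.{u}) (B : Type u) (_ : Lattice B) (_ : OrderBot B)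
        (ρ : Ordinal.{u} → Ordinal.{u} → B),
        Ladder.IsSpecialLadder κ n B ∧
        Ladder.IsPresentedBy P γ B ρ ∧
        ∀ α < γ, ∀ p : B, Ladder.IsClosedIn (Ladder.D ρ α p) α := by
  obtain ⟨P, i, -, -, h₁, h₂, h₃, h₄, -⟩ := Ladder.exists_special_ladder hκ n hsq
  exact ⟨P, i, h₁, h₂, h₃, h₄⟩
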